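/- For a regular uncountable cardinal $\lambda$, let $I[\lambda]$ be the family of all $A\subseteq\lambda$ such that $\{\delta\in A:\delta=\mathrm{cf}(\delta)\}$ is not stationary in $\lambda$ and there is a sequence $\langle\mathcal P_\alpha:\alpha<\lambda\rangle$ with the following two properties: (a) each $\mathcal P_\alpha$ is a family of fewer than $\lambda$ subsets of $\alpha$; (b) for every limit ordinal $\alpha\in A$ with $\mathrm{cf}(\alpha)<\alpha$ there is $x\subseteq\alpha$ with $\mathrm{otp}(x)<\alpha=\sup(x)$ such that $x\cap\zeta\in\bigcup_{\gamma<\alpha}\mathcal P_\gamma$ for every $\zeta<\alpha$. Theorem. Let $\kappa$ and $\lambda$ be regular (infinite) cardinals with $\kappa^+<\lambda$. Then there is a set $S\subseteq\{\delta<\lambda:\mathrm{cf}(\delta)=\kappa\}$ which is stationary in $\lambda$ and belongs to $I[\lambda]$. -/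

import Mathlib

universe u

/-- The order type of a set of ordinals (in the next universe, where sets of ordinals live). -/
noncomputable def orderTypeOf (x : Set Ordinal.{u}) : Ordinal.{u + 1} :=
  Ordinal.type (fun a b : x => a < b)

/-- A set `A` of ordinals is stationary in the ordinal `o`: its trace on `o = {a | a < o}`
meets every closed unbounded subset of `o`. -/
def StationaryIn (o : Ordinal.{u}) (A : Set Ordinal.{u}) : Prop :=
  IsStationary {a : Set.Iio o | (a : Ordinal.{u}) ∈ A}

/-- Shelah's ideal `I[lam]` (for `lam` a regular uncountable cardinal): the family of all
`A ⊆ lam` such that `{δ ∈ A | δ = cf δ}` is not stationary in `lam`, and for some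
`⟨P α | α < lam⟩`:
* every `P α` is a family of fewer than `lam` subsets of `α`;
* for every limit `α ∈ A` with `cf α < α` there is `x ⊆ α` with `otp x < α = sup x`
  all of whose proper initial segments `x ∩ ζ`, `ζ < α`, belong to `⋃ γ < α, P γ`. -/
def approachabilityIdeal (lam : Cardinal.{u}) : Set (Set Ordinal.{u}) :=
  {A | A ⊆ Set.Iio lam.ord ∧
    ¬ StationaryIn lam.ord {δ | δ ∈ A ∧ δ = δ.cof.ord} ∧
    ∃ P : Ordinal.{u} → Set (Set Ordinal.{u}),
      (∀ α < lam.ord, Cardinal.mk (P α) < Cardinal.lift.{u + 1} lam ∧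
        ∀ y ∈ P α, y ⊆ Set.Iio α) ∧
      ∀ α ∈ A, Order.IsSuccLimit α → α.cof.ord < α →
        ∃ x : Set Ordinal.{u}, x ⊆ Set.Iio α ∧
          orderTypeOf x < Ordinal.lift.{u + 1} α ∧ IsLUB x α ∧
          ∀ ζ < α, ∃ γ < α, x ∩ Set.Iio ζ ∈ P γ}

/-! It suffices to fix one small listing `P` such that every club of `lam` contains a point of
cofinality `κ` approached by `P` (`exists_stationary_mem_approachabilityIdeal`). There are two
cases.

If `lam` is the second successor of `κ`, fix injections `g d` of each `d` into `κ⁺` and list the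
sets `{a < b | g b a < i}`. For `d` of cofinality `κ`, a suitable closure point `i < κ⁺` makes these
sets cohere along `d`, so every such `d` is approached.

Otherwise put `σ = κ⁺⁺ < lam`. Guess clubs of `σ` by sets `C a` at points of cofinality `κ`
(`exists_club_guessing`), and list the images of the sets `C a ∩ i` under the suprema of fixed
cofinal `σ`-sequences `e d`. Given a club `E`, take a continuous `f` into `E` that outgrows the
stages at which its own pieces are listed. Then `f` agrees with the suprema of `e (f σ)` on a club
of `σ`. If `C a` lies in that club, `f '' C a` approaches `f a`. -/

open Cardinal Ordinal Set Order

/-! ### Clubs and continuous sequences in regular cardinals -/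

/-- `E` is a closed unbounded subset of the ordinal `o`. -/
structure IsClubIn (o : Ordinal.{u}) (E : Set Ordinal.{u}) : Prop where
  lt_of_mem : ∀ a ∈ E, a < o
  unbounded : ∀ a < o, ∃ b ∈ E, a < b
  closed : ∀ t ⊆ E, t.Nonempty → ∀ a < o, IsLUB t a → a ∈ E

theorem Cardinal.IsRegular.exists_strict_bound {c : Cardinal.{u}} (hc : c.IsRegular)
    {s : Set Ordinal.{u}} (hs : #s < Cardinal.lift.{u + 1} c) (h : ∀ a ∈ s, a < c.ord) :
    ∃ b < c.ord, ∀ a ∈ s, a < b := by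
  refine ⟨sSup ((· + 1) '' s), sSup_add_one_lt_of_lt_cof ?_ h, fun a ha => ?_⟩
  · rwa [← Ordinal.lift_cof, hc.cof_ord]
  · have hb : BddAbove ((· + 1) '' s) := by
      refine ⟨c.ord, ?_⟩
      rintro _ ⟨x, hx, rfl⟩
      exact Order.add_one_le_of_lt (h x hx)
    exact (lt_add_one a).trans_le (le_csSup hb ⟨a, ha, rfl⟩)

theorem mk_Iio_lt_lift {c : Cardinal.{u}} {a : Ordinal.{u}} (h : a < c.ord) :
    #(Iio a) < Cardinal.lift.{u + 1} c := by
  rw [Cardinal.mk_Iio_ordinal, Cardinal.lift_lt]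
  exact lt_ord.1 h

theorem mk_Iio_ord_eq (c : Cardinal.{u}) : #(Iio c.ord) = Cardinal.lift.{u + 1} c := by
  rw [Cardinal.mk_Iio_ordinal, card_ord]

theorem Cardinal.IsRegular.isSuccLimit_ord {c : Cardinal.{u}} (hc : c.IsRegular) :
    IsSuccLimit c.ord :=
  Cardinal.isSuccLimit_ord hc.aleph0_le

theorem IsClubIn.of_isClub {c : Cardinal.{u}} (hc : c.IsRegular) {t : Set (Iio c.ord)}
    (ht : IsClub t) : IsClubIn c.ord (Subtype.val '' t) where
  lt_of_mem := by
    rintro _ ⟨a, -, rfl⟩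
    exact a.2
  unbounded a ha := by
    obtain ⟨b, hb, hab⟩ := ht.isCofinal ⟨a + 1, hc.isSuccLimit_ord.add_one_lt ha⟩
    exact ⟨b, ⟨b, hb, rfl⟩, (lt_add_one a).trans_le hab⟩
  closed s hs hne a ha hlub := by
    refine ⟨⟨a, ha⟩, ht.isLUB_mem (t := Subtype.val ⁻¹' s) ?_ ?_ ?_, rfl⟩
    · intro b hb
      obtain ⟨b', hb', h⟩ := hs hb
      rwa [← Subtype.ext h]
    · obtain ⟨x, hx⟩ := hne
      obtain ⟨b', hb', h⟩ := hs hx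
      exact ⟨b', by rwa [mem_preimage, h]⟩
    · refine ⟨fun b hb => hlub.1 hb, fun b hb => hlub.2 fun x hx => ?_⟩
      obtain ⟨b', hb', h⟩ := hs hx
      have := hb (show b' ∈ Subtype.val ⁻¹' s by rwa [mem_preimage, h])
      rw [← h]
      exact this

theorem IsClubIn.inter_Ioi {o : Ordinal.{u}} {E : Set Ordinal.{u}} (hE : IsClubIn o E)
    {b : Ordinal.{u}} (hb : b < o) : IsClubIn o (E ∩ Ioi b) where
  lt_of_mem a ha := hE.lt_of_mem a ha.1
  unbounded a ha := by
    obtain ⟨c, hc, hac⟩ := hE.unbounded (max a b) (max_lt ha hb)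
    exact ⟨c, ⟨hc, (le_max_right a b).trans_lt hac⟩, (le_max_left a b).trans_lt hac⟩
  closed t ht hne a ha hlub := by
    refine ⟨hE.closed t (fun x hx => (ht hx).1) hne a ha hlub, ?_⟩
    obtain ⟨x, hx⟩ := hne
    exact (ht hx).2.trans_le (hlub.1 hx)

theorem IsClubIn.sSup_mem {o : Ordinal.{u}} {E : Set Ordinal.{u}} (hE : IsClubIn o E)
    {t : Set Ordinal.{u}} (ht : t ⊆ E) (hne : t.Nonempty) {a : Ordinal.{u}} (ha : a < o)
    (hta : ∀ x ∈ t, x ≤ a) : sSup t ∈ E :=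
  hE.closed t ht hne _ ((csSup_le hne hta).trans_lt ha) (isLUB_csSup hne ⟨a, hta⟩)

/-- An operation that raises every ordinal below an uncountable regular cardinal has arbitrarily
large limits of its iterates there. -/
theorem Cardinal.IsRegular.exists_iterate_limit {c : Cardinal.{u}} (hc : c.IsRegular) (h0 : ℵ₀ < c)
    {F : Ordinal.{u} → Ordinal.{u}} (hF : ∀ a < c.ord, F a < c.ord) (hF' : ∀ a < c.ord, a < F a)
    {a : Ordinal.{u}} (ha : a < c.ord) :
    ∃ b < c.ord, a < b ∧ (∀ n, F^[n] a < b) ∧ ∀ x < b, ∃ n, x < F^[n] a := by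
  have hlt : ∀ n, F^[n] a < c.ord := by
    intro n
    induction n with
    | zero => exact ha
    | succ n ih => rw [Function.iterate_succ_apply']; exact hF _ ih
  have h1 : ∀ n, F^[n] a < nfp F a := fun n => by
    refine (hF' _ (hlt n)).trans_le ?_
    rw [← Function.iterate_succ_apply' F n a]
    exact iterate_le_nfp F a (n + 1)
  exact ⟨nfp F a, nfp_lt_ord_of_isRegular hc h0.ne' hF ha, h1 0, h1, fun x hx => lt_nfp_iff.1 hx⟩

/-- Fewer than `c` next elements have a common bound below `c`; a limit of `ω` iterations of such
bounds is a limit of points of each `E i`. -/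
theorem IsClubIn.biInter {c : Cardinal.{u}} (hc : c.IsRegular) (h0 : ℵ₀ < c)
    {s : Set Ordinal.{u}} (hs : #s < Cardinal.lift.{u + 1} c) {E : Ordinal.{u} → Set Ordinal.{u}}
    (hE : ∀ i ∈ s, IsClubIn c.ord (E i)) :
    IsClubIn c.ord {a | a < c.ord ∧ ∀ i ∈ s, a ∈ E i} where
  lt_of_mem _ ha := ha.1
  unbounded a ha := by
    choose! next hnext hlt using fun i (hi : i ∈ s) => (hE i hi).unbounded
    have hB : ∀ b < c.ord, ∃ b' < c.ord, b < b' ∧ ∀ i ∈ s, next i b < b' := by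
      intro b hb
      obtain ⟨b', hb', h⟩ := hc.exists_strict_bound (s := (next · b) '' s)
        (mk_image_le.trans_lt hs) (by
          rintro _ ⟨i, hi, rfl⟩
          exact (hE i hi).lt_of_mem _ (hnext i hi b hb))
      refine ⟨max b' (b + 1), max_lt hb' (hc.isSuccLimit_ord.add_one_lt hb),
        (lt_add_one b).trans_le (le_max_right _ _), fun i hi => ?_⟩
      exact (h _ ⟨i, hi, rfl⟩).trans_le (le_max_left _ _)
    choose! F hF1 hF2 hF3 using hB
    obtain ⟨b, hb, hab, hnb, hbn⟩ := hc.exists_iterate_limit h0 hF1 hF2 ha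
    have hbc : ∀ n, F^[n] a < c.ord := fun n => (hnb n).trans hb
    refine ⟨b, ⟨hb, fun i hi => ?_⟩, hab⟩
    refine (hE i hi).closed (range fun n => next i (F^[n] a)) ?_ (range_nonempty _) b hb ⟨?_, ?_⟩
    · rintro _ ⟨n, rfl⟩
      exact hnext i hi _ (hbc n)
    · rintro _ ⟨n, rfl⟩
      refine ((hF3 _ (hbc n) i hi).trans ?_).le
      have := hnb (n + 1)
      rwa [Function.iterate_succ_apply'] at this
    · intro x hx
      by_contra! h
      obtain ⟨n, hn⟩ := hbn x h
      exact (hn.trans (hlt i hi _ (hbc n))).not_ge (hx ⟨n, rfl⟩)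
  closed t ht hne a ha hlub :=
    ⟨ha, fun i hi => (hE i hi).closed t (fun _ hx => (ht hx).2 i hi) hne a ha hlub⟩

/-- The closure points of a binary operation on an uncountable regular cardinal form a club. -/
theorem isClubIn_closurePoints {c : Cardinal.{u}} (hc : c.IsRegular) (h0 : ℵ₀ < c)
    {F : Ordinal.{u} → Ordinal.{u} → Ordinal.{u}} (hF : ∀ a < c.ord, ∀ b < c.ord, F a b < c.ord) :
    IsClubIn c.ord {i | i < c.ord ∧ IsSuccLimit i ∧ ∀ a < i, ∀ b < i, F a b < i} where
  lt_of_mem _ ha := ha.1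
  unbounded a ha := by
    have hB : ∀ m < c.ord, ∃ m' < c.ord, m < m' ∧ ∀ a < m, ∀ b < m, F a b < m' := by
      intro m hm
      obtain ⟨b', hb', h⟩ := hc.exists_strict_bound
        (s := (fun p : Ordinal × Ordinal => F p.1 p.2) '' (Iio m ×ˢ Iio m))
        (mk_image_le.trans_lt (by
          rw [mk_setProd]
          exact mul_lt_of_lt hc.lift.aleph0_le
            (mk_Iio_lt_lift hm) (mk_Iio_lt_lift hm))) (by
          rintro _ ⟨p, hp, rfl⟩
          exact hF _ (hp.1.trans hm) _ (hp.2.trans hm))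
      refine ⟨max b' (m + 1), max_lt hb' (hc.isSuccLimit_ord.add_one_lt hm),
        (lt_add_one m).trans_le (le_max_right _ _), fun a ha b hb => ?_⟩
      exact (h _ ⟨(a, b), ⟨ha, hb⟩, rfl⟩).trans_le (le_max_left _ _)
    choose! G hG1 hG2 hG3 using hB
    obtain ⟨i, hi, hai, hni, hin⟩ := hc.exists_iterate_limit h0 hG1 hG2 ha
    have hmono : Monotone fun n => G^[n] a := monotone_nat_of_le_succ fun n => by
      rw [Function.iterate_succ_apply']
      exact (hG2 _ ((hni n).trans hi)).le
    refine ⟨i, ⟨hi, ⟨not_isMin_of_lt hai, isSuccPrelimit_of_succ_lt fun x hx => ?_⟩,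
      fun x hx y hy => ?_⟩, hai⟩
    · obtain ⟨n, hn⟩ := hin x hx
      exact (Order.succ_le_of_lt hn).trans_lt (hni n)
    · obtain ⟨n, hn⟩ := hin x hx
      obtain ⟨m, hm⟩ := hin y hy
      have h1 := hn.trans_le (hmono (le_max_left n m))
      have h2 := hm.trans_le (hmono (le_max_right n m))
      refine (hG3 _ ((hni _).trans hi) x h1 y h2).trans ?_
      have := hni (max n m + 1)
      rwa [Function.iterate_succ_apply'] at this
  closed t ht hne a ha hlub := by
    by_cases hat : a ∈ t
    · exact ht hat
    have key : ∀ x < a, ∃ i ∈ t, x < i ∧ i < a := by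
      intro x hx
      obtain ⟨i, hi, hxi⟩ := (lt_isLUB_iff hlub).1 hx
      exact ⟨i, hi, hxi, (hlub.1 hi).lt_of_ne fun h => hat (h ▸ hi)⟩
    refine ⟨ha, ⟨?_, isSuccPrelimit_of_succ_lt fun x hx => ?_⟩,
      fun x hx y hy => ?_⟩
    · obtain ⟨i, hi⟩ := hne
      exact not_isMin_of_lt ((hlub.1 hi).lt_of_ne fun h => hat (h ▸ hi))
    · obtain ⟨i, hi, hxi, hia⟩ := key x hx
      exact (Order.succ_le_of_lt hxi).trans_lt hia
    · obtain ⟨i, hi, hxi, hia⟩ := key _ (max_lt hx hy)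
      exact ((ht hi).2.2 x ((le_max_left _ _).trans_lt hxi) y
        ((le_max_right _ _).trans_lt hxi)).trans hia

/-- A club of a regular cardinal contains a continuous increasing sequence which grows faster than a
given operation on its initial segments. -/
theorem IsClubIn.exists_continuous_seq {c : Cardinal.{u}} (hc : c.IsRegular) {E : Set Ordinal.{u}}
    (hE : IsClubIn c.ord E) (G : (Ordinal.{u} → Ordinal.{u}) → Ordinal.{u} → Ordinal.{u})
    (hG : ∀ f i, i < c.ord → G f i < c.ord)
    (hG' : ∀ f g i, (∀ j < i, f j = g j) → G f i = G g i) :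
    ∃ f : Ordinal.{u} → Ordinal.{u}, (∀ i < c.ord, f i ∈ E) ∧ StrictMonoOn f (Iio c.ord) ∧
      (∀ i < c.ord, ∀ j < i, G f j < f i) ∧
      ∀ i < c.ord, IsSuccLimit i → IsLUB (f '' Iio i) (f i) := by
  classical
  -- The default value 0 is harmless: by `hG'`, `G` at `j` sees only values below `j`.
  let ext (i : Ordinal.{u}) (h : ∀ j < i, Ordinal.{u}) : Ordinal.{u} → Ordinal.{u} :=
    fun j => if hj : j < i then h j hj else 0
  let f : Ordinal.{u} → Ordinal.{u} := lt_wf.fix fun i h =>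
    sInf {e | e ∈ E ∧ ∀ j < i, ext i h j < e ∧ G (ext i h) j < e}
  have hf : ∀ i, f i = sInf {e | e ∈ E ∧ ∀ j < i, f j < e ∧ G f j < e} := by
    intro i
    have h1 : ∀ j < i, ext i (fun k _ => f k) j = f j := fun j hj => dif_pos hj
    have h2 : f i = sInf {e | e ∈ E ∧ ∀ j < i, ext i (fun k _ => f k) j < e ∧
        G (ext i (fun k _ => f k)) j < e} := lt_wf.fix_eq _ i
    rw [h2]
    congr 1
    ext e
    refine and_congr_right fun _ => forall₂_congr fun j hj => ?_
    rw [h1 j hj, hG' _ f j fun k hk => h1 k (hk.trans hj)]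
  have hmem : ∀ i < c.ord, f i ∈ {e | e ∈ E ∧ ∀ j < i, f j < e ∧ G f j < e} := by
    intro i
    induction i using WellFoundedLT.induction with
    | ind i ih =>
      intro hi
      rw [hf i]
      refine csInf_mem ?_
      obtain ⟨b, hb, h⟩ := hc.exists_strict_bound (s := (fun j => max (f j) (G f j)) '' Iio i)
        (mk_image_le.trans_lt (mk_Iio_lt_lift hi)) (by
          rintro _ ⟨j, hj, rfl⟩
          exact max_lt (hE.lt_of_mem _ (ih j hj (lt_trans hj hi)).1) (hG _ _ (lt_trans hj hi)))
      obtain ⟨e, he, hbe⟩ := hE.unbounded b hb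
      exact ⟨e, he, fun j hj => max_lt_iff.1 ((h _ ⟨j, hj, rfl⟩).trans hbe)⟩
  refine ⟨f, fun i hi => (hmem i hi).1, fun i _ j hj hij => ((hmem j hj).2 i hij).1,
    fun i hi j hj => ((hmem i hi).2 j hj).2, fun i hi hlim => ⟨?_, fun b hb => ?_⟩⟩
  · rintro _ ⟨j, hj, rfl⟩
    exact ((hmem i hi).2 j hj).1.le
  · have hne : (f '' Iio i).Nonempty := ⟨f 0, 0, hlim.bot_lt, rfl⟩
    have hbd : ∀ x ∈ f '' Iio i, x ≤ f i := by
      rintro _ ⟨j, hj, rfl⟩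
      exact ((hmem i hi).2 j hj).1.le
    have hsup : sSup (f '' Iio i) ∈ E := hE.sSup_mem (by
      rintro _ ⟨j, hj, rfl⟩
      exact (hmem j (lt_trans hj hi)).1) hne (hE.lt_of_mem _ (hmem i hi).1) hbd
    refine le_trans ?_ (csSup_le hne hb)
    rw [hf i]
    -- Continuity: at a limit, the supremum of the earlier values already qualifies for the infimum
    -- defining `f i`.
    refine csInf_le' ⟨hsup, fun j hj => ?_⟩
    have hj' : j + 1 < i := hlim.add_one_lt hj
    have h3 := (hmem (j + 1) (hj'.trans hi)).2 j (lt_add_one j)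
    have h4 : f (j + 1) ≤ sSup (f '' Iio i) := le_csSup ⟨_, hbd⟩ ⟨_, hj', rfl⟩
    exact ⟨h3.1.trans_le h4, h3.2.trans_le h4⟩

theorem cof_eq_of_isLUB_image {f : Ordinal.{u} → Ordinal.{u}} {i d : Ordinal.{u}}
    (hf : StrictMonoOn f (Iio i)) (hi : IsSuccLimit i) (h : IsLUB (f '' Iio i) d) :
    d.cof = i.cof := by
  have h1 : StrictMono fun j : Iio i => f j := fun a b hab => hf a.2 b.2 hab
  have h2 : d = ⨆ j : Iio i, f j := by
    have : Nonempty (Iio i) := ⟨⟨0, hi.bot_lt⟩⟩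
    refine h.unique ?_
    rw [image_eq_range]
    exact isLUB_ciSup (by rw [← image_eq_range (f := f)]; exact ⟨d, h.1⟩)
  rw [h2, cof_iSup_Iio h1 hi.isSuccPrelimit]

/-! ### Club guessing -/

/-- The points at which `E` is approximated from below along `e`. -/
def clubGlue (E e : Set Ordinal.{u}) : Set Ordinal.{u} :=
  {b | ∃ a ∈ e, b = sSup (E ∩ Iic a) ∧ 0 < b}

theorem sSup_inter_Iic_le (E : Set Ordinal.{u}) (a : Ordinal.{u}) : sSup (E ∩ Iic a) ≤ a :=
  csSup_le' fun _ hx => hx.2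

theorem sSup_inter_Iic_mono {E E' : Set Ordinal.{u}} (h : E ⊆ E') (a : Ordinal.{u}) :
    sSup (E ∩ Iic a) ≤ sSup (E' ∩ Iic a) :=
  csSup_le_csSup' ⟨a, fun _ hx => hx.2⟩ (inter_subset_inter_left _ h)

theorem exists_cofinal_subset (o : Ordinal.{u}) :
    ∃ e ⊆ Iio o, #e = Cardinal.lift.{u + 1} o.cof ∧ ∀ a < o, ∃ b ∈ e, a ≤ b := by
  obtain ⟨s, hs, hs'⟩ := Order.exists_cof_eq (Iio o)
  refine ⟨Subtype.val '' s, ?_, ?_, fun a ha => ?_⟩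
  · rintro _ ⟨a, -, rfl⟩
    exact a.2
  · rw [mk_image_eq Subtype.val_injective, hs', Ordinal.cof_Iio, Ordinal.lift_cof]
  · obtain ⟨b, hb, hab⟩ := hs ⟨a, ha⟩
    exact ⟨b, ⟨b, hb, rfl⟩, hab⟩

/-- A sequence of ordinals that is antitone below an ordinal is eventually constant there. -/
theorem exists_eventually_const {o : Ordinal.{u}} (ho : 0 < o) {f : Ordinal.{u} → Ordinal.{u}}
    (hf : ∀ a b, a ≤ b → b < o → f b ≤ f a) : ∃ a < o, ∀ b, a ≤ b → b < o → f b = f a := by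
  obtain ⟨a, ha, hmin⟩ := exists_minimalFor_of_wellFoundedLT (· < o) f ⟨0, ho⟩
  exact ⟨a, ha, fun b hab hb => (hf a b hab hb).antisymm (hmin hb (hf a b hab hb))⟩

/-- Club guessing at the points of cofinality `κ` of a regular cardinal above the successor
of `κ`. -/
theorem exists_club_guessing {κ c : Cardinal.{u}} (hκ : κ.IsRegular) (hc : c.IsRegular)
    (h : succ κ < c) : ∃ C : Ordinal.{u} → Set Ordinal.{u}, ∀ D, IsClubIn c.ord D →
      ∃ a < c.ord, IsSuccLimit a ∧ a.cof = κ ∧ C a ⊆ D ∧ C a ⊆ Iio a ∧ IsLUB (C a) a ∧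
        #(C a) ≤ Cardinal.lift.{u + 1} κ := by
  by_contra! hno
  choose e he_lt he_card he_cof using exists_cofinal_subset.{u}
  choose D hD hDno using fun E : Set Ordinal.{u} => hno fun a => clubGlue E (e a)
  have hs : (succ κ).IsRegular := isRegular_succ hκ.aleph0_le
  have h0 : ℵ₀ < c := hs.aleph0_le.trans_lt h
  -- Each `E i` is the intersection of the clubs that defeat the guesses glued from the earlier `E
  -- j`.
  let E : Ordinal.{u} → Set Ordinal.{u} :=
    lt_wf.fix fun i E => {a | a < c.ord ∧ ∀ j, ∀ hj : j < i, a ∈ D (E j hj)}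
  have hE : ∀ i, E i = {a | a < c.ord ∧ ∀ j ∈ Iio i, a ∈ D (E j)} := fun i => lt_wf.fix_eq _ i
  have hanti : ∀ i j, i ≤ j → E j ⊆ E i := by
    intro i j hij a ha
    rw [hE] at ha ⊢
    exact ⟨ha.1, fun k hk => ha.2 k (lt_of_lt_of_le hk hij)⟩
  have hclub : ∀ i < c.ord, IsClubIn c.ord (E i) := by
    intro i hi
    rw [hE]
    exact .biInter hc h0 (mk_Iio_lt_lift hi) fun j _ => hD _
  obtain ⟨f, hfE, hfmono, -, hflub⟩ := (hclub _ (ord_lt_ord.2 h)).exists_continuous_seq hc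
    (fun _ _ => 0) (fun _ _ _ => hc.ord_pos) (fun _ _ _ _ => rfl)
  have hκc : κ.ord < c.ord := ord_lt_ord.2 ((lt_succ κ).trans h)
  set a := f κ.ord with ha
  have hac : a < c.ord := (hclub _ (ord_lt_ord.2 h)).lt_of_mem _ (hfE _ hκc)
  have hlub := hflub _ hκc hκ.isSuccLimit_ord
  have hcof : a.cof = κ := by
    rw [cof_eq_of_isLUB_image (hfmono.mono fun x hx => lt_trans hx hκc) hκ.isSuccLimit_ord hlub,
      hκ.cof_ord]
  have hlim : IsSuccLimit a := by
    rw [← Ordinal.one_lt_cof_iff, hcof]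
    exact_mod_cast hκ.nat_lt 1
  have hcardE : #(e a) < Cardinal.lift.{u + 1} (succ κ) := by
    rw [he_card, hcof, Cardinal.lift_lt]
    exact lt_succ κ
  choose z hz hzc using fun x : Ordinal.{u} => exists_eventually_const hs.ord_pos
    (f := fun i => sSup (E i ∩ Iic x)) fun i j hij _ => sSup_inter_Iic_mono (hanti i j hij) x
  -- Only `κ` many `x` in `e a` matter, so one stage below `κ⁺` stabilizes all their suprema. The
  -- glued set is then the same at `i` and `i + 1`, hence inside `D (E i)`.
  obtain ⟨i, hi, hzi⟩ := hs.exists_strict_bound (s := z '' e a) (mk_image_le.trans_lt hcardE) (by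
    rintro _ ⟨x, -, rfl⟩
    exact hz x)
  have hi' : i + 1 < (succ κ).ord := hs.isSuccLimit_ord.add_one_lt hi
  have hEsub : E (i + 1) ⊆ D (E i) := by
    intro x hx
    rw [hE] at hx
    exact hx.2 i (lt_add_one i)
  have hstable : ∀ x ∈ e a, sSup (E i ∩ Iic x) = sSup (E (i + 1) ∩ Iic x) := by
    intro x hx
    have hzx : z x ≤ i := (hzi _ ⟨x, hx, rfl⟩).le
    rw [hzc x i hzx hi, hzc x (i + 1) (hzx.trans (lt_add_one i).le) hi']
  refine (hDno (E i) a hac hlim hcof ?_ ?_ ?_).not_ge ?_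
  · rintro b ⟨x, hx, rfl, hpos⟩
    rw [hstable x hx] at hpos ⊢
    refine hEsub ((hclub _ (hi'.trans (ord_lt_ord.2 h))).sSup_mem inter_subset_left ?_
      ((he_lt a hx).trans hac) fun y hy => hy.2)
    -- The clause `0 < b` in `clubGlue` excludes the junk supremum of the empty set.
    by_contra hemp
    rw [not_nonempty_iff_eq_empty.1 hemp, csSup_empty] at hpos
    exact lt_irrefl _ hpos
  · rintro b ⟨x, hx, rfl, -⟩
    exact (sSup_inter_Iic_le _ _).trans_lt (he_lt a hx)
  · refine ⟨?_, fun b hb => ?_⟩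
    · rintro b ⟨x, hx, rfl, -⟩
      exact ((sSup_inter_Iic_le _ _).trans_lt (he_lt a hx)).le
    · by_contra! hba
      obtain ⟨_, ⟨j, hj, rfl⟩, hbj⟩ := (lt_isLUB_iff hlub).1 hba
      have hjc : j < c.ord := lt_trans hj hκc
      obtain ⟨x, hx, hjx⟩ := he_cof a (f j) (hfmono hjc hκc hj)
      have hle : f j ≤ sSup (E i ∩ Iic x) :=
        le_csSup ⟨x, fun y hy => hy.2⟩ ⟨hanti _ _ hi.le (hfE j hjc), hjx⟩
      exact (hbj.trans_le hle).not_ge (hb ⟨x, hx, rfl, zero_le.trans_lt (hbj.trans_le hle)⟩)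
  · have hsub : clubGlue (E i) (e a) ⊆ (fun x => sSup (E i ∩ Iic x)) '' e a := by
      rintro b ⟨x, hx, rfl, -⟩
      exact ⟨x, hx, rfl⟩
    refine (mk_le_mk_of_subset hsub).trans (mk_image_le.trans ?_)
    rw [he_card, hcof]

/-! ### From approached points to the ideal -/

/-- `x` is a small cofinal subset of `d` whose proper initial segments are listed by `P` below
`d`. -/
structure IsApproachedBy (κ : Cardinal.{u}) (P : Ordinal.{u} → Set (Set Ordinal.{u}))
    (d : Ordinal.{u}) (x : Set Ordinal.{u}) : Prop where
  subset_Iio : x ⊆ Iio d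
  mk_le : #x ≤ Cardinal.lift.{u + 1} κ
  isLUB : IsLUB x d
  initial_mem : ∀ b < d, ∃ a < d, x ∩ Iio b ∈ P a

theorem orderTypeOf_lt {κ : Cardinal.{u}} {x : Set Ordinal.{u}} {d : Ordinal.{u}}
    (hx : #x ≤ Cardinal.lift.{u + 1} κ) (hd : (succ κ).ord < d) :
    orderTypeOf x < Ordinal.lift.{u + 1} d := by
  refine lt_trans ?_ (Ordinal.lift_lt.2 hd)
  rw [Cardinal.lift_ord, lt_ord, orderTypeOf, card_type]
  exact hx.trans_lt (Cardinal.lift_lt.2 (lt_succ κ))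

theorem exists_stationary_mem_approachabilityIdeal {κ lam : Cardinal.{u}} (hlam : lam.IsRegular)
    (h : succ κ < lam) (P : Ordinal.{u} → Set (Set Ordinal.{u}))
    (hP : ∀ a < lam.ord, #(P a) < Cardinal.lift.{u + 1} lam ∧ ∀ y ∈ P a, y ⊆ Iio a)
    (hS : ∀ E, IsClubIn lam.ord E → ∃ d ∈ E, d.cof = κ ∧ ∃ x, IsApproachedBy κ P d x) :
    ∃ S : Set Ordinal.{u}, S ⊆ {d | d < lam.ord ∧ d.cof = κ} ∧
      StationaryIn lam.ord S ∧ S ∈ approachabilityIdeal lam := by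
  -- Requiring `d` to exceed `κ⁺` excludes regular points and makes the order type of `x` smaller
  -- than `d`.
  refine ⟨{d | d < lam.ord ∧ d.cof = κ ∧ (succ κ).ord < d ∧ ∃ x, IsApproachedBy κ P d x},
    fun d hd => ⟨hd.1, hd.2.1⟩, fun t ht => ?_, fun d hd => hd.1, ?_, P, hP, ?_⟩
  · obtain ⟨d, ⟨⟨d', hd', rfl⟩, hdκ⟩, hcof, hx⟩ :=
      hS _ ((IsClubIn.of_isClub hlam ht).inter_Ioi (ord_lt_ord.2 h))
    exact ⟨d', ⟨d'.2, hcof, hdκ, hx⟩, hd'⟩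
  · intro hst
    obtain ⟨d, ⟨-, hcof, hdκ, -⟩, hd⟩ := hst.nonempty
    rw [hcof] at hd
    rw [hd] at hdκ
    exact hdκ.not_gt (ord_lt_ord.2 (lt_succ κ))
  · rintro d ⟨-, -, hdκ, x, hx⟩ - -
    exact ⟨x, hx.subset_Iio, orderTypeOf_lt hx.mk_le hdκ, hx.isLUB, hx.initial_mem⟩

/-! ### The second successor of `κ` -/

/-- The pieces of size at most `κ` of a family of injections into the successor of `κ` approach
every point of cofinality `κ` below the second successor. -/
theorem exists_isApproachedBy_of_injOn {κ : Cardinal.{u}} (hκ : κ.IsRegular)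
    {g : Ordinal.{u} → Ordinal.{u} → Ordinal.{u}}
    (hg : ∀ d < (succ (succ κ)).ord, InjOn (g d) (Iio d))
    (hg' : ∀ d < (succ (succ κ)).ord, ∀ a < d, g d a < (succ κ).ord)
    {P : Ordinal.{u} → Set (Set Ordinal.{u})}
    (hP : ∀ d, ∀ i < (succ κ).ord, {a | a < d ∧ g d a < i} ∈ P (d + 1))
    {d : Ordinal.{u}} (hd : d < (succ (succ κ)).ord) (hcof : d.cof = κ) :
    ∃ x, IsApproachedBy κ P d x := by
  have hs : (succ κ).IsRegular := isRegular_succ hκ.aleph0_le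
  have h0 : ℵ₀ < succ κ := hκ.aleph0_le.trans_lt (lt_succ κ)
  have hlim : IsSuccLimit d := by
    rw [← Ordinal.one_lt_cof_iff, hcof]
    exact_mod_cast hκ.nat_lt 1
  obtain ⟨e, he, he_card, he_cof⟩ := exists_cofinal_subset d
  obtain ⟨i₀, hi₀, hei⟩ := hs.exists_strict_bound (s := g d '' e)
    (mk_image_le.trans_lt (by
      rw [he_card, hcof, Cardinal.lift_lt]
      exact lt_succ κ)) (by
    rintro _ ⟨a, ha, rfl⟩
    exact hg' d hd a (he ha))
  let p (b i : Ordinal.{u}) : Ordinal.{u} := Function.invFunOn (g b) (Iio b) i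
  have hp : ∀ b < (succ (succ κ)).ord, ∀ a < b, p b (g b a) = a := fun b hb a ha =>
    (hg b hb).leftInvOn_invFunOn ha
  -- `cut` only makes the operation below total on `κ⁺`; it is the identity on genuine codes.
  let cut (i : Ordinal.{u}) : Ordinal.{u} := if i < (succ κ).ord then i else 0
  have hcut : ∀ i, cut i < (succ κ).ord := by
    intro i
    by_cases hi : i < (succ κ).ord
    · rwa [show cut i = i from if_pos hi]
    · rw [show cut i = 0 from if_neg hi]
      exact hs.ord_pos
  have hcut' : ∀ i < (succ κ).ord, cut i = i := fun i hi => if_pos hi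
  -- With `j` the code of `b` in `d`, the two components translate the code of `a` in `b` to that in
  -- `d` and back. Closure under both gives the coherence `hcoh`.
  obtain ⟨i, ⟨hi, -, hcl⟩, hii⟩ := (isClubIn_closurePoints hs h0
    (F := fun j k => max (cut (g d (p (p d j) k))) (cut (g (p d j) (p d k))))
    fun j _ k _ => max_lt (hcut _) (hcut _)).unbounded i₀ hi₀
  have hcoh : ∀ b < d, g d b < i → ∀ a < b, (g b a < i ↔ g d a < i) := by
    intro b hb hbi a hab
    have hb' := hb.trans hd
    constructor
    · intro hai
      have := (max_lt_iff.1 (hcl _ hbi _ hai)).1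
      rwa [hp d hd b hb, hp b hb' a hab, hcut' _ (hg' d hd a (hab.trans hb))] at this
    · intro hai
      have := (max_lt_iff.1 (hcl _ hbi _ hai)).2
      rwa [hp d hd b hb, hp d hd a (hab.trans hb), hcut' _ (hg' b hb' a hab)] at this
  refine ⟨{a | a < d ∧ g d a < i}, fun a ha => ha.1, ?_, ⟨fun a ha => ha.1.le, fun b hb => ?_⟩,
    fun b hb => ?_⟩
  · rw [← Order.lt_succ_iff, ← Cardinal.lift_succ]
    refine lt_of_le_of_lt ?_ (mk_Iio_lt_lift hi)
    rw [← mk_image_eq_of_injOn (g d) _ ((hg d hd).mono fun a ha => ha.1)]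
    refine mk_le_mk_of_subset ?_
    rintro _ ⟨a, ha, rfl⟩
    exact ha.2
  · by_contra! hbd
    obtain ⟨a, ha, hba⟩ := he_cof (b + 1) (hlim.add_one_lt hbd)
    exact ((lt_add_one b).trans_le hba).not_ge (hb ⟨he ha, (hei _ ⟨a, ha, rfl⟩).trans hii⟩)
  · obtain ⟨a₀, ha₀, hba₀⟩ := he_cof b hb
    -- For the least element `a ≥ b` of the piece, cutting at `b` or at `a` is the same, and the cut
    -- at `a` is a listed set by coherence.
    obtain ⟨a, ⟨hba, had, hai⟩, hmin⟩ := exists_minimal_of_wellFoundedLT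
      (fun a => b ≤ a ∧ a < d ∧ g d a < i)
      ⟨a₀, hba₀, he ha₀, (hei _ ⟨a₀, ha₀, rfl⟩).trans hii⟩
    refine ⟨a + 1, hlim.add_one_lt had, ?_⟩
    convert hP a i hi using 1
    ext y
    constructor
    · rintro ⟨⟨hyd, hyi⟩, hyb⟩
      have hya : y < a := lt_of_lt_of_le hyb hba
      exact ⟨hya, (hcoh a had hai y hya).2 hyi⟩
    · rintro ⟨hya, hyi⟩
      have hyi' := (hcoh a had hai y hya).1 hyi
      refine ⟨⟨hya.trans had, hyi'⟩, ?_⟩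
      by_contra hby
      exact hya.not_ge (hmin ⟨not_lt.1 hby, hya.trans had, hyi'⟩ hya.le)

theorem mk_prod_Iio_lt {c lam : Cardinal.{u}} (hlam : lam.IsRegular) (hc : c < lam)
    {a : Ordinal.{u}} (ha : a < lam.ord) :
    #(Iio a ×ˢ Iio c.ord : Set (Ordinal.{u} × Ordinal.{u})) < Cardinal.lift.{u + 1} lam := by
  rw [mk_setProd]
  exact mul_lt_of_lt hlam.lift.aleph0_le (mk_Iio_lt_lift ha)
    (mk_Iio_lt_lift (ord_lt_ord.2 hc))

theorem exists_stationary_of_succ_succ {κ : Cardinal.{u}} (hκ : κ.IsRegular) :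
    ∃ S : Set Ordinal.{u}, S ⊆ {d | d < (succ (succ κ)).ord ∧ d.cof = κ} ∧
      StationaryIn (succ (succ κ)).ord S ∧ S ∈ approachabilityIdeal (succ (succ κ)) := by
  have hs : (succ κ).IsRegular := isRegular_succ hκ.aleph0_le
  have hlam : (succ (succ κ)).IsRegular := isRegular_succ hs.aleph0_le
  have hinj : ∀ d < (succ (succ κ)).ord, ∃ g : Ordinal.{u} → Ordinal.{u}, InjOn g (Iio d) ∧
      ∀ a < d, g a < (succ κ).ord := by
    intro d hd
    have hle : #(Iio d) ≤ #(Iio (succ κ).ord) := by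
      rw [Cardinal.mk_Iio_ordinal, mk_Iio_ord_eq, Cardinal.lift_le, ← Order.lt_succ_iff]
      exact lt_ord.1 hd
    obtain ⟨φ⟩ := hle
    classical
    refine ⟨fun a => if ha : a < d then φ ⟨a, ha⟩ else 0, fun a ha b hb hab => ?_, fun a ha => ?_⟩
    · have ha' : a < d := ha
      have hb' : b < d := hb
      simp only [ha', hb', dif_pos] at hab
      exact congrArg Subtype.val (φ.injective (Subtype.ext hab))
    · simp only [ha, dif_pos]
      exact (φ ⟨a, ha⟩).2
  choose! g hg hg' using hinj
  let P : Ordinal.{u} → Set (Set Ordinal.{u}) := fun b =>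
    (fun q : Ordinal.{u} × Ordinal.{u} => {a | a < q.1 ∧ g q.1 a < q.2}) ''
      (Iio b ×ˢ Iio (succ κ).ord)
  refine exists_stationary_mem_approachabilityIdeal hlam (lt_succ _) P (fun b hb => ⟨?_, ?_⟩) ?_
  · exact mk_image_le.trans_lt (mk_prod_Iio_lt hlam (lt_succ _) hb)
  · rintro _ ⟨q, hq, rfl⟩ a ha
    exact ha.1.trans hq.1
  · intro E hE
    obtain ⟨f, hfE, hfmono, -, hflub⟩ := hE.exists_continuous_seq hlam
      (fun _ _ => 0) (fun _ _ _ => hlam.ord_pos) (fun _ _ _ _ => rfl)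
    have hκc : κ.ord < (succ (succ κ)).ord := ord_lt_ord.2 ((lt_succ κ).trans (lt_succ _))
    have hcof : (f κ.ord).cof = κ := by
      rw [cof_eq_of_isLUB_image (hfmono.mono fun x hx => lt_trans hx hκc) hκ.isSuccLimit_ord
        (hflub _ hκc hκ.isSuccLimit_ord), hκ.cof_ord]
    exact ⟨_, hfE _ hκc, hcof, exists_isApproachedBy_of_injOn hκ hg hg'
      (P := P)
      (fun d i hi => ⟨(d, i), ⟨lt_add_one d, hi⟩, rfl⟩) (hE.lt_of_mem _ (hfE _ hκc)) hcof⟩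

/-! ### Cardinals above the second successor of `κ` -/

/-- `e` maps the ordinals below `o` cofinally into `d`. -/
def IsCofinalSeq (o d : Ordinal.{u}) (e : Ordinal.{u} → Ordinal.{u}) : Prop :=
  (∀ i < o, e i < d) ∧ ∀ a < d, ∃ i < o, a < e i

/-- Two cofinal sequences of regular uncountable length, the first one continuous, agree at club
many points after passing to suprema. -/
theorem exists_club_eq_sSup_image {c : Cardinal.{u}} (hc : c.IsRegular) (h0 : ℵ₀ < c)
    {d : Ordinal.{u}} {e f : Ordinal.{u} → Ordinal.{u}} (he : IsCofinalSeq c.ord d e)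
    (hf : IsCofinalSeq c.ord d f) (hlub : ∀ i < c.ord, IsSuccLimit i → IsLUB (f '' Iio i) (f i)) :
    ∃ D, IsClubIn c.ord D ∧ ∀ i ∈ D, f i = sSup (e '' Iio i) := by
  -- At points closed under `up` and `dn` the initial segments of `e` and `f` interleave.
  choose! up hup hup' using fun j (hj : j < c.ord) => he.2 _ (hf.1 j hj)
  choose! dn hdn hdn' using fun j (hj : j < c.ord) => hf.2 _ (he.1 j hj)
  refine ⟨_, isClubIn_closurePoints hc h0 (F := fun j _ => max (up j) (dn j))
    fun j hj _ _ => max_lt (hup j hj) (hdn j hj), ?_⟩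
  rintro i ⟨hi, hlim, hcl⟩
  have hcl' : ∀ j < i, up j < i ∧ dn j < i := fun j hj => max_lt_iff.1 (hcl j hj j hj)
  have hbd : ∀ x ∈ e '' Iio i, x ≤ f i := by
    rintro _ ⟨j, hj, rfl⟩
    exact (hdn' j (lt_trans hj hi)).le.trans ((hlub i hi hlim).1 ⟨_, (hcl' j hj).2, rfl⟩)
  refine le_antisymm ((hlub i hi hlim).2 ?_) (csSup_le' hbd)
  rintro _ ⟨j, hj, rfl⟩
  exact (hup' j (lt_trans hj hi)).le.trans (le_csSup ⟨_, hbd⟩ ⟨_, (hcl' j hj).1, rfl⟩)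

theorem exists_stationary_of_succ_succ_lt {κ lam : Cardinal.{u}} (hκ : κ.IsRegular)
    (hlam : lam.IsRegular) (h : succ (succ κ) < lam) :
    ∃ S : Set Ordinal.{u}, S ⊆ {d | d < lam.ord ∧ d.cof = κ} ∧
      StationaryIn lam.ord S ∧ S ∈ approachabilityIdeal lam := by
  have hσ₀ : ℵ₀ < succ (succ κ) :=
    hκ.aleph0_le.trans_lt ((lt_succ κ).trans (lt_succ _))
  have hσ : (succ (succ κ)).IsRegular := isRegular_succ (isRegular_succ hκ.aleph0_le).aleph0_le
  have hκσ : succ κ < succ (succ κ) := lt_succ (succ κ)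
  obtain ⟨C, hC⟩ := exists_club_guessing hκ hσ hκσ
  generalize succ (succ κ) = σ at *
  have hσlam : σ.ord < lam.ord := ord_lt_ord.2 h
  -- The sequences must be fixed before `E` is given, since `P` depends on them; `id` is a junk
  -- value.
  have hsel : ∀ d, ∃ e, (∃ e', IsCofinalSeq σ.ord d e') → IsCofinalSeq σ.ord d e := by
    intro d
    by_cases hd : ∃ e', IsCofinalSeq σ.ord d e'
    · exact ⟨hd.choose, fun _ => hd.choose_spec⟩
    · exact ⟨id, fun h => (hd h).elim⟩
  choose e he using hsel
  let piece (q : Ordinal.{u} × Ordinal.{u} × Ordinal.{u}) : Set Ordinal.{u} :=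
    (fun k => sSup (e q.1 '' Iio k)) '' (C q.2.1 ∩ Iio q.2.2)
  let P : Ordinal.{u} → Set (Set Ordinal.{u}) := fun b =>
    {y | y ⊆ Iio b ∧ y ∈ piece '' (Iio b ×ˢ Iio σ.ord ×ˢ Iio σ.ord)}
  refine exists_stationary_mem_approachabilityIdeal hlam (hκσ.trans h) P
    (fun b hb => ⟨?_, fun y hy => hy.1⟩) ?_
  · refine (mk_le_mk_of_subset fun y hy => hy.2).trans_lt (mk_image_le.trans_lt ?_)
    rw [mk_setProd]
    exact mul_lt_of_lt hlam.lift.aleph0_le (mk_Iio_lt_lift hb) (mk_prod_Iio_lt hlam h hσlam)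
  intro E hE
  -- The least stage listing `y`, or 0 if there is none. It is defined without reference to `f σ`,
  -- so `f` can outgrow it during its own recursion.
  let idx (y : Set Ordinal.{u}) : Ordinal.{u} := sInf {b | b < lam.ord ∧ y ∈ P b}
  have hidx : ∀ y, idx y < lam.ord := by
    intro y
    rcases {b | b < lam.ord ∧ y ∈ P b}.eq_empty_or_nonempty with hy | hy
    · simpa only [idx, hy, Ordinal.sInf_empty] using hlam.ord_pos
    · exact (csInf_mem hy).1
  have hbdd : ∀ (f : Ordinal.{u} → Ordinal.{u}) i,
      ∀ x ∈ (fun a => idx (f '' (C a ∩ Iio i))) '' Iio σ.ord, x < lam.ord := by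
    rintro f i _ ⟨a, -, rfl⟩
    exact hidx _
  obtain ⟨f, hfE, hfmono, hfG, hflub⟩ := hE.exists_continuous_seq hlam
    (fun f i => sSup ((fun a => idx (f '' (C a ∩ Iio i))) '' Iio σ.ord))
    (fun f i _ => sSup_lt_of_lt_cof (by
      rw [← Ordinal.lift_cof, hlam.cof_ord]
      exact mk_image_le.trans_lt (mk_Iio_lt_lift hσlam)) (hbdd f i))
    (fun f g i hfg => by
      have : ∀ a, f '' (C a ∩ Iio i) = g '' (C a ∩ Iio i) := fun a =>
        image_congr fun j hj => hfg j hj.2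
      simp only [this])
  have hfσ : IsCofinalSeq σ.ord (f σ.ord) f := by
    refine ⟨fun i hi => hfmono (hi.trans hσlam) hσlam hi, fun a ha => ?_⟩
    obtain ⟨_, ⟨i, hi, rfl⟩, hai⟩ :=
      (lt_isLUB_iff (hflub _ hσlam hσ.isSuccLimit_ord)).1 ha
    exact ⟨i, hi, hai⟩
  obtain ⟨D, hD, hDeq⟩ := exists_club_eq_sSup_image hσ hσ₀ (he _ ⟨f, hfσ⟩) hfσ
    fun i hi => hflub i (hi.trans hσlam)
  obtain ⟨a, ha, halim, hacof, haD, haa, halub, hacard⟩ := hC D hD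
  have halam : a < lam.ord := ha.trans hσlam
  -- The point `f σ` lies above `f a`, so this stage is too late; it only shows that the pieces are
  -- listed somewhere, whence `idx` is meaningful and `hfG` puts it below `f a`.
  have hknown : ∀ i < σ.ord, f '' (C a ∩ Iio i) ∈ P (f σ.ord + 1) := by
    intro i hi
    refine ⟨?_, (f σ.ord, a, i), ⟨lt_add_one (f σ.ord), ha, hi⟩, ?_⟩
    · rintro _ ⟨k, hk, rfl⟩
      exact (hfσ.1 k ((haa hk.1).trans ha)).trans (lt_add_one _)
    · exact image_congr fun k hk => (hDeq k (haD hk.1)).symm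
  have hfσlam : f σ.ord + 1 < lam.ord :=
    hlam.isSuccLimit_ord.add_one_lt (hE.lt_of_mem _ (hfE _ hσlam))
  have hfa := hflub a halam halim
  refine ⟨f a, hfE a halam, ?_, f '' C a, ?_, mk_image_le.trans hacard, ⟨?_, fun b hb => ?_⟩,
    fun b hb => ?_⟩
  · rw [cof_eq_of_isLUB_image (hfmono.mono fun x hx => lt_trans hx halam) halim hfa, hacof]
  · rintro _ ⟨k, hk, rfl⟩
    exact hfmono ((haa hk).trans halam) halam (haa hk)
  · rintro _ ⟨k, hk, rfl⟩
    exact (hfmono ((haa hk).trans halam) halam (haa hk)).le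
  · refine hfa.2 ?_
    rintro _ ⟨j, hj, rfl⟩
    obtain ⟨k, hk, hjk⟩ := (lt_isLUB_iff halub).1 hj
    exact (hfmono (lt_trans hj halam) ((haa hk).trans halam) hjk).le.trans (hb ⟨k, hk, rfl⟩)
  · obtain ⟨_, ⟨i₀, hi₀, rfl⟩, hbi₀⟩ := (lt_isLUB_iff hfa).1 hb
    -- By minimality of `i`, cutting the image at `b` amounts to cutting `C a` at `i`.
    obtain ⟨i, ⟨hia, hbi⟩, hmin⟩ := exists_minimal_of_wellFoundedLT
      (fun i => i < a ∧ b ≤ f i) ⟨i₀, hi₀, hbi₀.le⟩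
    have hseg : f '' C a ∩ Iio b = f '' (C a ∩ Iio i) := by
      ext y
      constructor
      · rintro ⟨⟨k, hk, rfl⟩, hkb⟩
        refine ⟨k, ⟨hk, ?_⟩, rfl⟩
        exact (hfmono.lt_iff_lt ((haa hk).trans halam) (hia.trans halam)).1
          (lt_of_lt_of_le hkb hbi)
      · rintro ⟨k, ⟨hk, hki⟩, rfl⟩
        refine ⟨⟨k, hk, rfl⟩, ?_⟩
        by_contra hkb
        exact (show k < i from hki).not_ge (hmin ⟨haa hk, not_lt.1 hkb⟩ (le_of_lt hki))
    have hmem : idx (f '' (C a ∩ Iio i)) ∈ {b | b < lam.ord ∧ f '' (C a ∩ Iio i) ∈ P b} :=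
      csInf_mem ⟨_, hfσlam, hknown i (hia.trans ha)⟩
    refine ⟨idx (f '' (C a ∩ Iio i)), lt_of_le_of_lt ?_ (hfG a halam i hia), ?_⟩
    · exact le_csSup ⟨lam.ord, fun x hx => (hbdd f i x hx).le⟩ ⟨a, ha, rfl⟩
    · rw [hseg]
      exact hmem.2

theorem mainTheorem2 (κ lam : Cardinal.{u}) (hκ : κ.IsRegular) (hlam : lam.IsRegular)
    (h : Order.succ κ < lam) :
    ∃ S : Set Ordinal.{u}, S ⊆ {δ | δ < lam.ord ∧ δ.cof = κ} ∧
      StationaryIn lam.ord S ∧ S ∈ approachabilityIdeal lam := by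
  rcases (succ_le_of_lt h).eq_or_lt with rfl | h'
  · exact exists_stationary_of_succ_succ hκ
  · exact exists_stationary_of_succ_succ_lt hκ hlam h'
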